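/- **Uniqueness of the solution.** Let $\alpha\in(0,1)$, $\theta<1$, $0\le a<T<\infty$, $p=1-\theta$, and let $\beta\in(0,2)$, $\beta\neq 1$. Put $Av=-(x^{\beta}v')'$ and $\Omega=(0,1)\times(a,T]$. Let $$D_t\,g(t)=p^{\alpha}t^{-p\alpha}\Big(1-\alpha+\frac tp\frac{d}{dt}\Big)\Big[\frac{t^{-p(1-\alpha)}}{\Gamma(1-\alpha)}\int_a^t (t^p-\tau^p)^{-\alpha}g(\tau)\,d(\tau^p)\Big]-\frac{p^{\alpha}\,g(a)\,(t^p-a^p)^{-\alpha}}{\Gamma(1-\alpha)},\qquad a<t\le T,$$ be the regularized Caputo-like counterpart of the hyper-Bessel operator of order $\alpha$ with starting point $a$. Consider the mixed problem $$D_t u-\frac{\partial}{\partial x}\Big(x^{\beta}\frac{\partial u}{\partial x}\Big)=f\ \text{ in }\Omega,\qquad u(x,a+)=\varphi(x)\ (0\le x\le1),\qquad u(1,t)=0\ (a\le t\le T),$$ with, when $0<\beta<1$, the additional condition $u(0,t)=0$ for $a\le t\le T$ (no condition at $x=0$ when $1<\beta<2$). 1. Let $0<\beta<1$. For all functions $f$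 and $\varphi$ the problem has at most one classical solution: if $u_1,u_2\in C(\overline\Omega)$, with $D_tu_i$ and $Au_i$ existing and continuous in $\Omega$, both satisfy the equation, the initial condition and the boundary conditions, then $u_1=u_2$ on $\overline\Omega=[0,1]\times[a,T]$. 2. Let $1<\beta<2$. Let $\dot W=\dot W^{1}_{2,\beta}(0,1)$ be the closure, in the norm $\big(\int_0^1 (v^2+x^{\beta}v'^2)\,dx\big)^{1/2}$, of the set $D(A)$ of all $v\in C[0,1]$ with $x^{\beta}v'\in C[0,1]$, $(x^{\beta}v')'\in AC[0,1]$ and $v(1)=0$, and denote the Friedrichs extension of $A|_{D(A)}$ in $L^2(0,1)$ again by $A$. For every $f:(a,T]\to L^2(0,1)$ and every $\varphi\in L^2(0,1)$ the problem has at most one weak solution. Here a weak solution is a function $u\in C([a,T],L^2(0,1))\cap C((a,T],\dot W)$ with $Au\in C((a,T],L^2(0,1))$ such that $u(\cdot,t)\to\varphi$ in $L^2(0,1)$ as $t\to a+$ and, for all $\omega\in\dot W$ and $t\in(a,T]$, the derivative $D_t(u,\omega)_{L^2(0,1)}$ exists and $$D_t\,(u,\omega)_{L^2(0,1)}+\int_0^1x^{\beta}\,\frac{\partial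 u}{\partial x}\,\omega'\,dx=(f,\omega)_{L^2(0,1)} .$$ That is, any two weak solutions $u_1,u_2$ with the same data satisfy $u_1(\cdot,t)=u_2(\cdot,t)$ in $L^2(0,1)$ for all $t\in[a,T]$. -/

import Mathlib

open MeasureTheory Set Filter Topology

noncomputable section

namespace DegenerateFractional

/-- The Erdelyi-Kober fractional integral with starting point `a`,
`t ^ (-b (γ + δ)) / Γ(δ) * ∫_a^t (t ^ b - τ ^ b) ^ (δ - 1) τ ^ (b γ) g(τ) d(τ ^ b)`,
where `d(τ ^ b) = b τ ^ (b - 1) dτ`. -/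
def ekIntegral (b γ δ a : ℝ) (g : ℝ → ℝ) (t : ℝ) : ℝ :=
  t ^ (-b * (γ + δ)) / Real.Gamma δ *
    ∫ τ in a..t, (t ^ b - τ ^ b) ^ (δ - 1) * τ ^ (b * γ) * g τ * (b * τ ^ (b - 1))

/-- The Erdelyi-Kober fractional derivative of order `0 < δ < 1` on `(a, T]`,
`(γ + 1 + (t / b) d/dt)` applied to the Erdelyi-Kober integral with parameters `γ + δ`, `1 - δ`
(the derivative at `t = T` is the one from the left). -/
def ekDeriv (b γ δ a T : ℝ) (g : ℝ → ℝ) (t : ℝ) : ℝ :=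
  (γ + 1) * ekIntegral b (γ + δ) (1 - δ) a g t +
    t / b * derivWithin (ekIntegral b (γ + δ) (1 - δ) a g) (Ioc a T) t

/-- The hyper-Bessel fractional differential operator of order `0 < α < 1`, for `θ < 1`:
`(1 - θ) ^ α t ^ (-(1 - θ) α) I^{0, -α}`, where `I^{0, -α}`, the Erdelyi-Kober integral of
negative order, stands for the Erdelyi-Kober derivative `D^{-α, α}`. -/
def hyperBessel (α θ a T : ℝ) (g : ℝ → ℝ) (t : ℝ) : ℝ :=
  (1 - θ) ^ α * t ^ (-(1 - θ) * α) * ekDeriv (1 - θ) (-α) α a T g t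

/-- The regularized Caputo-like counterpart of the hyper-Bessel operator on `(a, T]`. -/
def caputoHyperBessel (α θ a T : ℝ) (g : ℝ → ℝ) (t : ℝ) : ℝ :=
  hyperBessel α θ a T g t -
    g a * (t ^ (1 - θ) - a ^ (1 - θ)) ^ (-α) / ((1 - θ) ^ (-α) * Real.Gamma (1 - α))

/-- The hyper-Bessel derivative (equivalently, its Caputo-like counterpart) of `g` exists at every
point of `(a, T]`: the function differentiated in `ekDeriv` is differentiable there. -/
def HasHyperBessel (α θ a T : ℝ) (g : ℝ → ℝ) : Prop :=
  DifferentiableOn ℝ (ekIntegral (1 - θ) (-α + α) (1 - α) a g) (Ioc a T)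

/-- The differential expression `A v = -(x ^ β v')'`. -/
def opA (β : ℝ) (v : ℝ → ℝ) (x : ℝ) : ℝ :=
  -deriv (fun y => y ^ β * deriv v y) x

/-- `u` is a classical solution of
`ᶜ((t - a) ^ θ ∂_t) ^ α u - ∂_x (x ^ β ∂_x u) = f` in `(0, 1) × (a, T]`, `u(x, a+) = φ(x)`,
`u(1, t) = 0` and, when `β < 1`, also `u(0, t) = 0`. -/
structure IsClassicalSolution (α θ β a T : ℝ) (f : ℝ → ℝ → ℝ) (φ : ℝ → ℝ)
    (u : ℝ → ℝ → ℝ) : Prop where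
  continuousOn : ContinuousOn (fun z : ℝ × ℝ => u z.1 z.2) (Icc 0 1 ×ˢ Icc a T)
  time_exists : ∀ x ∈ Ioo (0 : ℝ) 1, HasHyperBessel α θ a T (u x)
  time_continuousOn : ContinuousOn
    (fun z : ℝ × ℝ => caputoHyperBessel α θ a T (u z.1) z.2) (Ioo 0 1 ×ˢ Ioc a T)
  space_exists : ∀ t ∈ Ioc a T, ∀ x ∈ Ioo (0 : ℝ) 1,
    DifferentiableAt ℝ (fun y => u y t) x ∧
      DifferentiableAt ℝ (fun y => y ^ β * deriv (fun y' => u y' t) y) x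
  space_continuousOn : ContinuousOn
    (fun z : ℝ × ℝ => opA β (fun y => u y z.2) z.1) (Ioo 0 1 ×ˢ Ioc a T)
  equation : ∀ x ∈ Ioo (0 : ℝ) 1, ∀ t ∈ Ioc a T,
    caputoHyperBessel α θ a T (u x) t + opA β (fun y => u y t) x = f x t
  initial : ∀ x ∈ Icc (0 : ℝ) 1, Tendsto (u x) (𝓝[>] a) (𝓝 (φ x))
  boundary_left : β < 1 → ∀ t ∈ Icc a T, u 0 t = 0
  boundary_right : ∀ t ∈ Icc a T, u 1 t = 0

/-- The real Hilbert space `L²(0, 1)`. -/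
abbrev L2 : Type := Lp ℝ 2 (volume.restrict (Ioo (0 : ℝ) 1))

/-- The domain `D(A)`: `v ∈ C[0, 1]`, `x ^ β v' ∈ C[0, 1]` (this is `w`), `(x ^ β v')' ∈ AC[0, 1]`
(this is `z`; in particular `A v = -z ∈ L²(0, 1)`), `v(1) = 0` and, when `β < 1`, `v(0) = 0`. -/
structure MemDomainA (β : ℝ) (v : ℝ → ℝ) : Prop where
  continuousOn : ContinuousOn v (Icc 0 1)
  differentiableAt : ∀ x ∈ Ioo (0 : ℝ) 1, DifferentiableAt ℝ v x
  flux : ∃ w z : ℝ → ℝ, ContinuousOn w (Icc 0 1) ∧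
    (∀ x ∈ Ioo (0 : ℝ) 1, w x = x ^ β * deriv v x) ∧
    (∀ x ∈ Ioo (0 : ℝ) 1, HasDerivAt w (z x) x) ∧
    AbsolutelyContinuousOnInterval z 0 1
  boundary_left : β < 1 → v 0 = 0
  boundary_right : v 1 = 0

/-- The pairs `(v, x ^ (β / 2) v')` in `L²(0, 1) × L²(0, 1)` with `v ∈ D(A)`. -/
def domainGraph (β : ℝ) : Set (L2 × L2) :=
  {p | ∃ v : ℝ → ℝ, MemDomainA β v ∧
    (p.1 =ᵐ[volume.restrict (Ioo (0 : ℝ) 1)] v) ∧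
    (p.2 =ᵐ[volume.restrict (Ioo (0 : ℝ) 1)] fun x => x ^ (β / 2) * deriv v x)}

/-- The weighted space `W`, the closure of `D(A)` in the norm
`(∫ v² + x ^ β v'²) ^ (1 / 2)`. An element `v` is recorded together with its weighted derivative,
as the pair `(v, x ^ (β / 2) v')`; the second component is determined by the first, and the norm
of `W` is equivalent to the norm of the pair in `L² × L²`. -/
def weightedSobolev (β : ℝ) : Set (L2 × L2) := closure (domainGraph β)

/-- `u` is a weak solution of the problem with data `f`, `φ`. Here `d t` is the weighted derivative
`x ^ (β / 2) ∂_x u(·, t)`, and `g t` is `A u(·, t)`, for the Friedrichs extension of `A`, which is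
the operator of the form `∫ x ^ β v' ω'` on `W`. -/
structure IsWeakSolution (α θ β a T : ℝ) (f : ℝ → L2) (φ : L2) (u : ℝ → L2) : Prop where
  continuousOn : ContinuousOn u (Icc a T)
  initial : Tendsto u (𝓝[>] a) (𝓝 φ)
  weak : ∃ d g : ℝ → L2,
    (∀ t ∈ Ioc a T, (u t, d t) ∈ weightedSobolev β) ∧
    ContinuousOn d (Ioc a T) ∧
    (∀ t ∈ Ioc a T, ∀ ω ∈ weightedSobolev β, inner ℝ (d t) ω.2 = inner ℝ (g t) ω.1) ∧
    ContinuousOn g (Ioc a T) ∧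
    ∀ ω ∈ weightedSobolev β,
      HasHyperBessel α θ a T (fun t => inner ℝ (u t) ω.1) ∧
      ∀ t ∈ Ioc a T,
        caputoHyperBessel α θ a T (fun s => inner ℝ (u s) ω.1) t + inner ℝ (d t) ω.2 =
          inner ℝ (f t) ω.1

end DegenerateFractional

end

/-!
In the variable `s = t ^ (1 - θ)` the operator `D_t` becomes, up to a positive constant, the
Riemann–Liouville derivative `d/ds I^{1 - α}`. Since `I^α I^{1 - α} g = ∫ g`, a continuous `g` for
which `I^{1 - α} g` is increasing is nonnegative. Applied to a quantity that vanishes at the end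
point, this shows that `D_t g(t) > 0` wherever `g` attains a maximum over `[a, t]` exceeding `g(a)`,
although `g` itself need not be differentiable.

For `β < 1`, at an interior maximum of a classical solution `D_t u` is positive there while
`A u ≥ 0`, a contradiction when `f ≤ 0`: this is a maximum principle, hence uniqueness. For weak
solutions let `u` be the difference of two of them and test its equation with `ω = u(t₀)`, where
`t₀` maximizes `‖u(t)‖`. By Cauchy–Schwarz `(u(t), ω)` is maximal at `t₀`, so `D_t (u, ω)(t₀)` is
positive unless `u = 0`, whereas the equation makes it minus an energy.
-/

namespace DegenerateFractional

/-- The Riemann–Liouville fractional integral of order `μ` with starting point `a`, to which the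
Erdelyi-Kober integral reduces in the variable `s = t ^ b`. -/
noncomputable def rlIntegral (μ a : ℝ) (g : ℝ → ℝ) (x : ℝ) : ℝ :=
  (Real.Gamma μ)⁻¹ * ∫ σ in a..x, (x - σ) ^ (μ - 1) * g σ

section RiemannLiouville

variable {μ ν a b x : ℝ} {g g₁ g₂ : ℝ → ℝ}

theorem intervalIntegrable_sub_rpow {r : ℝ} (hr : -1 < r) (x b c : ℝ) :
    IntervalIntegrable (fun σ => (x - σ) ^ r) volume b c := by
  simpa using
    (intervalIntegral.intervalIntegrable_rpow' (a := x - b) (b := x - c) hr).comp_sub_left x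

theorem intervalIntegrable_sub_rpow_mul {c : ℝ} (hμ : 0 < μ) (x : ℝ)
    (hg : ContinuousOn g (uIcc b c)) :
    IntervalIntegrable (fun σ => (x - σ) ^ (μ - 1) * g σ) volume b c :=
  (intervalIntegrable_sub_rpow (by linarith) x b c).mul_continuousOn hg

theorem rlIntegral_self : rlIntegral μ a g a = 0 := by
  simp [rlIntegral]

theorem rlIntegral_one : rlIntegral 1 a g x = ∫ σ in a..x, g σ := by
  simp [rlIntegral]

theorem rlIntegral_const (hμ : 0 < μ) (c : ℝ) :
    rlIntegral μ a (fun _ => c) x = (x - a) ^ μ / Real.Gamma (μ + 1) * c := by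
  rw [rlIntegral, intervalIntegral.integral_mul_const,
    intervalIntegral.integral_comp_sub_left (fun z => z ^ (μ - 1)) x,
    integral_rpow (Or.inl (by linarith)), Real.Gamma_add_one hμ.ne', sub_self, sub_add_cancel,
    Real.zero_rpow hμ.ne']
  field_simp
  ring

theorem rlIntegral_sub (hμ : 0 < μ) (h₁ : ContinuousOn g₁ (uIcc a x))
    (h₂ : ContinuousOn g₂ (uIcc a x)) :
    rlIntegral μ a (g₁ - g₂) x = rlIntegral μ a g₁ x - rlIntegral μ a g₂ x := by
  simp only [rlIntegral, Pi.sub_apply, mul_sub]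
  rw [intervalIntegral.integral_sub (intervalIntegrable_sub_rpow_mul hμ x h₁)
    (intervalIntegrable_sub_rpow_mul hμ x h₂), mul_sub]

theorem integral_sub_rpow_mul_sub_rpow (hμ : 0 < μ) (hν : 0 < ν) {y : ℝ} (hyx : y < x) :
    ∫ σ in y..x, (x - σ) ^ (μ - 1) * (σ - y) ^ (ν - 1) =
      Real.Gamma μ * Real.Gamma ν / Real.Gamma (μ + ν) * (x - y) ^ (μ + ν - 1) := by
  have hd : 0 < x - y := sub_pos.2 hyx
  have hbeta := Complex.betaIntegral_scaled ν μ hd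
  have hint : ∫ z in (0 : ℝ)..(x - y),
      (z : ℂ) ^ ((ν : ℂ) - 1) * ((x - y : ℝ) - z : ℂ) ^ ((μ : ℂ) - 1) =
      ((∫ z in (0 : ℝ)..(x - y), (x - y - z) ^ (μ - 1) * z ^ (ν - 1) : ℝ) : ℂ) := by
    rw [← intervalIntegral.integral_ofReal]
    refine intervalIntegral.integral_congr fun z hz => ?_
    rw [uIcc_of_le hd.le] at hz
    push_cast [Complex.ofReal_cpow (sub_nonneg.2 hz.2), Complex.ofReal_cpow hz.1]
    ring
  rw [hint, Complex.betaIntegral_eq_Gamma_mul_div _ _ (by simpa) (by simpa), Complex.Gamma_ofReal,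
    Complex.Gamma_ofReal, ← Complex.ofReal_add, Complex.Gamma_ofReal] at hbeta
  have hshift := intervalIntegral.integral_comp_sub_right (a := y) (b := x)
    (fun z => (x - y - z) ^ (μ - 1) * z ^ (ν - 1)) y
  simp only [sub_self, sub_sub_sub_cancel_right] at hshift
  rw [hshift]
  apply Complex.ofReal_injective
  rw [hbeta]
  push_cast [Complex.ofReal_cpow hd.le]
  ring_nf

theorem intervalIntegrable_sub_rpow_mul_sub_rpow (hμ : 0 < μ) (hν : 0 < ν) {y : ℝ} (hyx : y < x) :
    IntervalIntegrable (fun σ => (x - σ) ^ (μ - 1) * (σ - y) ^ (ν - 1)) volume y x := by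
  refine intervalIntegral.intervalIntegrable_of_integral_ne_zero ?_
  rw [integral_sub_rpow_mul_sub_rpow hμ hν hyx]
  have := Real.rpow_pos_of_pos (sub_pos.2 hyx) (μ + ν - 1)
  have := Real.Gamma_pos_of_pos hμ
  have := Real.Gamma_pos_of_pos hν
  have := Real.Gamma_pos_of_pos (add_pos hμ hν)
  positivity

/-- The open triangle `a < τ < σ < b`, the domain of integration of the iterated integrals
`∫ σ in a..b, ∫ τ in a..σ` and `∫ τ in a..b, ∫ σ in τ..b`. -/
def openTriangle (a b : ℝ) : Set (ℝ × ℝ) := {z | a < z.2 ∧ z.2 < z.1 ∧ z.1 < b}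

theorem isOpen_openTriangle : IsOpen (openTriangle a b) :=
  (isOpen_lt continuous_const continuous_snd).inter
    ((isOpen_lt continuous_snd continuous_fst).inter (isOpen_lt continuous_fst continuous_const))

theorem indicator_openTriangle_eq_indicator_fst {E : Type*} [Zero E] (F : ℝ × ℝ → E) (σ τ : ℝ) :
    (openTriangle a b).indicator F (σ, τ) =
      (Ioo a b).indicator (fun σ => (Ioo a σ).indicator (fun τ => F (σ, τ)) τ) σ := by
  simp only [openTriangle, indicator_apply, mem_ofPred_eq, mem_Ioo]
  grind

theorem indicator_openTriangle_eq_indicator_snd {E : Type*} [Zero E] (F : ℝ × ℝ → E) (σ τ : ℝ) :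
    (openTriangle a b).indicator F (σ, τ) =
      (Ioo a b).indicator (fun τ => (Ioo τ b).indicator (fun σ => F (σ, τ)) σ) τ := by
  simp only [openTriangle, indicator_apply, mem_ofPred_eq, mem_Ioo]
  grind

section Triangle

variable {E : Type*} [NormedAddCommGroup E] [NormedSpace ℝ E] {F : ℝ × ℝ → E}

theorem integral_indicator_openTriangle_fst (σ : ℝ) :
    ∫ τ, (openTriangle a b).indicator F (σ, τ) =
      (Ioo a b).indicator (fun σ => ∫ τ in a..σ, F (σ, τ)) σ := by
  simp only [indicator_openTriangle_eq_indicator_fst]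
  by_cases hσ : σ ∈ Ioo a b
  · simp only [indicator_of_mem hσ, integral_indicator measurableSet_Ioo]
    rw [intervalIntegral.integral_of_le hσ.1.le, integral_Ioc_eq_integral_Ioo]
  · simp [indicator_of_notMem hσ]

theorem integral_indicator_openTriangle_snd (τ : ℝ) :
    ∫ σ, (openTriangle a b).indicator F (σ, τ) =
      (Ioo a b).indicator (fun τ => ∫ σ in τ..b, F (σ, τ)) τ := by
  simp only [indicator_openTriangle_eq_indicator_snd]
  by_cases hτ : τ ∈ Ioo a b
  · simp only [indicator_of_mem hτ, integral_indicator measurableSet_Ioo]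
    rw [intervalIntegral.integral_of_le hτ.2.le, integral_Ioc_eq_integral_Ioo]
  · simp [indicator_of_notMem hτ]

theorem intervalIntegral_swap_of_integrableOn_openTriangle (hab : a ≤ b)
    (hF : IntegrableOn F (openTriangle a b)) :
    ∫ σ in a..b, ∫ τ in a..σ, F (σ, τ) = ∫ τ in a..b, ∫ σ in τ..b, F (σ, τ) := by
  rw [← integrable_indicator_iff isOpen_openTriangle.measurableSet] at hF
  have hswap := integral_integral_swap
    (f := fun σ τ => (openTriangle a b).indicator F (σ, τ)) hF
  simp only [integral_indicator_openTriangle_fst, integral_indicator_openTriangle_snd,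
    integral_indicator measurableSet_Ioo, ← integral_Ioc_eq_integral_Ioo,
    ← intervalIntegral.integral_of_le hab] at hswap
  exact hswap

end Triangle

theorem aestronglyMeasurable_rlKernel_mul (hg : ContinuousOn g (Icc a x)) :
    AEStronglyMeasurable
      (fun z : ℝ × ℝ => (x - z.1) ^ (μ - 1) * (z.1 - z.2) ^ (ν - 1) * g z.2)
      (volume.restrict (openTriangle a x)) := by
  have hkernel : Measurable fun z : ℝ × ℝ => (x - z.1) ^ (μ - 1) * (z.1 - z.2) ^ (ν - 1) := by
    fun_prop
  have hg_snd : ContinuousOn (fun z : ℝ × ℝ => g z.2) (openTriangle a x) :=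
    hg.comp continuousOn_snd fun z hz => ⟨hz.1.le, (hz.2.1.trans hz.2.2).le⟩
  exact hkernel.aestronglyMeasurable.mul
    (hg_snd.aestronglyMeasurable isOpen_openTriangle.measurableSet)

theorem integral_norm_sub_rpow_mul_sub_rpow_mul (hμ : 0 < μ) (hν : 0 < ν) {y : ℝ} (hyx : y < x)
    (c : ℝ) :
    ∫ σ in y..x, ‖(x - σ) ^ (μ - 1) * (σ - y) ^ (ν - 1) * c‖ =
      Real.Gamma μ * Real.Gamma ν / Real.Gamma (μ + ν) * ((x - y) ^ (μ + ν - 1) * ‖c‖) := by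
  rw [← mul_assoc, ← integral_sub_rpow_mul_sub_rpow hμ hν hyx,
    ← intervalIntegral.integral_mul_const]
  refine intervalIntegral.integral_congr fun σ hσ => ?_
  rw [uIcc_of_le hyx.le] at hσ
  simp only [norm_mul, Real.norm_of_nonneg (Real.rpow_nonneg (sub_nonneg.2 hσ.1) _),
    Real.norm_of_nonneg (Real.rpow_nonneg (sub_nonneg.2 hσ.2) _)]

theorem integrableOn_openTriangle_rlKernel_mul (hμ : 0 < μ) (hν : 0 < ν) (hax : a ≤ x)
    (hg : ContinuousOn g (Icc a x)) :
    IntegrableOn (fun z : ℝ × ℝ => (x - z.1) ^ (μ - 1) * (z.1 - z.2) ^ (ν - 1) * g z.2)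
      (openTriangle a x) := by
  have hmeas := (aestronglyMeasurable_indicator_iff isOpen_openTriangle.measurableSet).2
    (aestronglyMeasurable_rlKernel_mul (μ := μ) (ν := ν) hg)
  rw [← integrable_indicator_iff isOpen_openTriangle.measurableSet, Measure.volume_eq_prod,
    integrable_prod_iff' hmeas]
  constructor
  · refine Eventually.of_forall fun τ => ?_
    simp only [indicator_openTriangle_eq_indicator_snd]
    by_cases hτ : τ ∈ Ioo a x
    · simp only [indicator_of_mem hτ, integrable_indicator_iff measurableSet_Ioo]
      exact (intervalIntegrable_iff_integrableOn_Ioo_of_le hτ.2.le).1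
        ((intervalIntegrable_sub_rpow_mul_sub_rpow hμ hν hτ.2).mul_const _)
    · simp [indicator_of_notMem hτ]
  · simp only [norm_indicator_eq_indicator_norm, integral_indicator_openTriangle_snd]
    have hg_norm := intervalIntegrable_sub_rpow_mul (add_pos hμ hν) x (b := a) (c := x)
      (by rw [uIcc_of_le hax]; exact hg.norm)
    rw [integrable_indicator_iff measurableSet_Ioo, integrableOn_congr_fun
      (fun τ hτ => integral_norm_sub_rpow_mul_sub_rpow_mul hμ hν hτ.2 (g τ)) measurableSet_Ioo]
    exact ((intervalIntegrable_iff_integrableOn_Ioo_of_le hax).1 hg_norm).const_mul _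

theorem rlIntegral_rlIntegral (hμ : 0 < μ) (hν : 0 < ν) (hax : a ≤ x)
    (hg : ContinuousOn g (Icc a x)) :
    rlIntegral μ a (rlIntegral ν a g) x = rlIntegral (μ + ν) a g x := by
  have hinner : ∀ σ, (x - σ) ^ (μ - 1) * rlIntegral ν a g σ = (Real.Gamma ν)⁻¹ *
      ∫ τ in a..σ, (x - σ) ^ (μ - 1) * (σ - τ) ^ (ν - 1) * g τ := fun σ => by
    simp only [mul_assoc, intervalIntegral.integral_const_mul, rlIntegral]
    ring
  have houter : ∫ τ in a..x, ∫ σ in τ..x, (x - σ) ^ (μ - 1) * (σ - τ) ^ (ν - 1) * g τ =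
      Real.Gamma μ * Real.Gamma ν / Real.Gamma (μ + ν) *
        ∫ τ in a..x, (x - τ) ^ (μ + ν - 1) * g τ := by
    simp only [← intervalIntegral.integral_const_mul, intervalIntegral.integral_mul_const]
    refine intervalIntegral.integral_congr_Ioo_of_le hax fun τ hτ => ?_
    rw [integral_sub_rpow_mul_sub_rpow hμ hν hτ.2, mul_assoc]
  rw [rlIntegral, rlIntegral]
  simp only [hinner, intervalIntegral.integral_const_mul]
  rw [intervalIntegral_swap_of_integrableOn_openTriangle hax
    (integrableOn_openTriangle_rlKernel_mul hμ hν hax hg), houter]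
  field_simp

theorem rlIntegral_eq_integral_comp_sub :
    rlIntegral μ a g x = (Real.Gamma μ)⁻¹ * ∫ z in 0..x - a, z ^ (μ - 1) * g (x - z) := by
  have := intervalIntegral.integral_comp_sub_left (a := a) (b := x)
    (fun z => z ^ (μ - 1) * g (x - z)) x
  simp only [sub_sub_cancel, sub_self] at this
  rw [rlIntegral, this]

theorem intervalIntegrable_rpow_mul_comp_sub (hμ : 0 < μ) (hax : a ≤ x)
    (hg : MonotoneOn g (Icc a x)) :
    IntervalIntegrable (fun z => z ^ (μ - 1) * g (x - z)) volume 0 (x - a) := by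
  have h0 : 0 ≤ x - a := sub_nonneg.2 hax
  have hrefl : AntitoneOn (fun z => g (x - z)) (Icc 0 (x - a)) := fun z hz w hw hzw =>
    hg (by grind) (by grind) (by grind)
  have hpow : IntervalIntegrable (fun z : ℝ => z ^ (μ - 1)) volume 0 (x - a) :=
    intervalIntegral.intervalIntegrable_rpow' (by linarith)
  rw [intervalIntegrable_iff_integrableOn_Icc_of_le h0] at hpow ⊢
  refine hpow.mul_bdd (c := max |g a| |g x|)
    (aemeasurable_restrict_of_antitoneOn measurableSet_Icc hrefl).aestronglyMeasurable
    ((ae_restrict_mem measurableSet_Icc).mono fun z hz => ?_)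
  have hz' : x - z ∈ Icc a x := by grind
  exact abs_le_max_abs_abs (hg (left_mem_Icc.2 hax) hz' hz'.1)
    (hg hz' (right_mem_Icc.2 hax) hz'.2)

theorem monotoneOn_rlIntegral (hμ : 0 < μ) (hg : MonotoneOn g (Icc a b)) (hga : 0 ≤ g a) :
    MonotoneOn (rlIntegral μ a g) (Icc a b) := by
  intro x hx y hy hxy
  have hxa : 0 ≤ x - a := sub_nonneg.2 hx.1
  have hint : ∀ s ∈ Icc a b,
      IntervalIntegrable (fun z => z ^ (μ - 1) * g (s - z)) volume 0 (s - a) := fun s hs =>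
    intervalIntegrable_rpow_mul_comp_sub hμ hs.1 (hg.mono (Icc_subset_Icc_right hs.2))
  have hint_y : IntervalIntegrable (fun z => z ^ (μ - 1) * g (y - z)) volume 0 (x - a) :=
    (hint y hy).mono_set (by
      rw [uIcc_of_le hxa, uIcc_of_le (sub_nonneg.2 hy.1)]
      exact Icc_subset_Icc_right (by linarith))
  simp only [rlIntegral_eq_integral_comp_sub]
  refine mul_le_mul_of_nonneg_left ?_ (inv_nonneg.2 (Real.Gamma_pos_of_pos hμ).le)
  calc ∫ z in 0..x - a, z ^ (μ - 1) * g (x - z)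
      ≤ ∫ z in 0..x - a, z ^ (μ - 1) * g (y - z) :=
        intervalIntegral.integral_mono_on hxa (hint x hx) hint_y fun z hz =>
          mul_le_mul_of_nonneg_left (hg (by grind) (by grind) (by linarith))
            (Real.rpow_nonneg hz.1 _)
    _ ≤ ∫ z in 0..y - a, z ^ (μ - 1) * g (y - z) := by
        refine intervalIntegral.integral_mono_interval le_rfl hxa (by linarith)
          ((ae_restrict_mem measurableSet_Ioc).mono fun z hz => ?_) (hint y hy)
        have hz' : y - z ∈ Icc a b := by grind
        exact mul_nonneg (Real.rpow_nonneg hz.1.le _)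
          (hga.trans (hg (left_mem_Icc.2 (hx.1.trans hx.2)) hz' hz'.1))

theorem nonneg_of_monotoneOn_rlIntegral (hμ : μ ∈ Ioo (0 : ℝ) 1) (hab : a < b)
    (hg : ContinuousOn g (Icc a b)) (hmono : MonotoneOn (rlIntegral (1 - μ) a g) (Icc a b))
    (hx : x ∈ Icc a b) : 0 ≤ g x := by
  have hprim : MonotoneOn (fun y => ∫ σ in a..y, g σ) (Icc a b) := by
    refine (monotoneOn_rlIntegral hμ.1 hmono rlIntegral_self.ge).congr fun y hy => ?_
    rw [rlIntegral_rlIntegral hμ.1 (sub_pos.2 hμ.2) hy.1 (hg.mono (Icc_subset_Icc_right hy.2)),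
      add_sub_cancel, rlIntegral_one]
  have : Fact (x ∈ Icc a b) := ⟨hx⟩
  have hderiv : HasDerivWithinAt (fun y => ∫ σ in a..y, g σ) (g x) (Icc a b) x :=
    intervalIntegral.integral_hasDerivWithinAt_right
      ((hg.mono (Icc_subset_Icc_right hx.2)).intervalIntegrable_of_Icc hx.1)
      (hg.stronglyMeasurableAtFilter_nhdsWithin measurableSet_Icc x) (hg x hx)
  exact hderiv.nonneg_of_monotoneOn
    (uniqueDiffWithinAt_iff_accPt.1 (uniqueDiffOn_Icc hab x hx)) hprim

/- Subtract `c • rlIntegral μ a 1`, whose `rlIntegral` of order `1 - μ` is `c * (x - a)`. -/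
theorem le_of_monotoneOn_rlIntegral_sub_mul {c : ℝ} (hμ : μ ∈ Ioo (0 : ℝ) 1) (hab : a < b)
    (hg : ContinuousOn g (Icc a b))
    (hmono : MonotoneOn (fun x => rlIntegral (1 - μ) a g x - c * (x - a)) (Icc a b))
    (hx : x ∈ Icc a b) : (x - a) ^ μ / Real.Gamma (μ + 1) * c ≤ g x := by
  have h1μ : 0 < 1 - μ := sub_pos.2 hμ.2
  have hpow : ContinuousOn (rlIntegral μ a fun _ => c) (Icc a b) := by
    simp only [funext fun x => rlIntegral_const (a := a) (x := x) hμ.1 c]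
    exact ((((continuous_id.sub continuous_const).rpow_const fun _ => Or.inr hμ.1.le).div_const
      _).mul_const c).continuousOn
  rw [← rlIntegral_const hμ.1, ← sub_nonneg]
  refine nonneg_of_monotoneOn_rlIntegral (g := g - rlIntegral μ a fun _ => c) hμ hab
    (hg.sub hpow) (hmono.congr fun y hy => ?_) hx
  have hsub : uIcc a y ⊆ Icc a b := by
    rw [uIcc_of_le hy.1]
    exact Icc_subset_Icc_right hy.2
  rw [rlIntegral_sub h1μ (hg.mono hsub) (hpow.mono hsub),
    rlIntegral_rlIntegral h1μ hμ.1 hy.1 continuousOn_const, sub_add_cancel,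
    rlIntegral_const one_pos]
  norm_num
  ring

theorem monotoneOn_rlIntegral_sub_rlIntegral {r s : ℝ} (hμ : μ ∈ Ioc (0 : ℝ) 1) (har : a ≤ r)
    (hg : ContinuousOn g (Icc a s)) (hnonneg : ∀ x ∈ Icc a r, 0 ≤ g x) :
    MonotoneOn (fun x => rlIntegral μ r g x - rlIntegral μ a g x) (Icc r s) := by
  intro x hx y hy hxy
  have hint : ∀ z b c, b ∈ Icc a s → c ∈ Icc a s →
      IntervalIntegrable (fun σ => (z - σ) ^ (μ - 1) * g σ) volume b c := fun z b c hb hc =>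
    intervalIntegrable_sub_rpow_mul hμ.1 z (hg.mono (uIcc_subset_Icc hb hc))
  have ha : a ∈ Icc a s := ⟨le_rfl, har.trans (hx.1.trans hx.2)⟩
  have hr : r ∈ Icc a s := ⟨har, hx.1.trans hx.2⟩
  have hsplit : ∀ z ∈ Icc r s, rlIntegral μ r g z - rlIntegral μ a g z =
      -((Real.Gamma μ)⁻¹ * ∫ σ in a..r, (z - σ) ^ (μ - 1) * g σ) := fun z hz => by
    have hz' : z ∈ Icc a s := ⟨har.trans hz.1, hz.2⟩
    rw [rlIntegral, rlIntegral, ← intervalIntegral.integral_add_adjacent_intervals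
      (hint z a r ha hr) (hint z r z hr hz')]
    ring
  simp only [hsplit x hx, hsplit y hy]
  refine neg_le_neg (mul_le_mul_of_nonneg_left ?_ (inv_nonneg.2 (Real.Gamma_pos_of_pos hμ.1).le))
  refine intervalIntegral.integral_mono_on_of_le_Ioo har (hint y a r ha hr) (hint x a r ha hr)
    fun σ hσ => mul_le_mul_of_nonneg_right ?_ (hnonneg σ (Ioo_subset_Icc_self hσ))
  exact Real.rpow_le_rpow_of_nonpos (by linarith [hσ.2, hx.1]) (by linarith) (by linarith [hμ.2])

/- If `q s` were positive, `rlIntegral (1 - μ) a g` would grow at a positive rate on some `[r, s]`.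
Restarting the integral at `r` only adds to the growth, since `g ≥ 0`, and so forces `g s > 0`. -/
theorem hasDerivWithinAt_rlIntegral_nonpos_of_eq_zero {s : ℝ} {q : ℝ → ℝ}
    (hμ : μ ∈ Ioo (0 : ℝ) 1) (has : a < s) (hg : ContinuousOn g (Icc a s))
    (hnonneg : ∀ x ∈ Icc a s, 0 ≤ g x) (hgs : g s = 0)
    (hd : ∀ x ∈ Ioc a s, HasDerivWithinAt (rlIntegral (1 - μ) a g) (q x) (Ioc a s) x)
    (hq : ContinuousWithinAt q (Ioc a s) s) : q s ≤ 0 := by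
  by_contra! hqs
  obtain ⟨r, hrs, hr⟩ : ∃ r < s, ∀ x ∈ Icc r s, x ∈ Ioc a s ∧ q s / 2 < q x := by
    have hev : ∀ᶠ x in 𝓝[≤] s, x ∈ Ioc a s ∧ q s / 2 < q x := by
      rw [ContinuousWithinAt, nhdsWithin_Ioc_eq_nhdsLE has] at hq
      filter_upwards [Ioc_mem_nhdsLE has, hq.eventually (lt_mem_nhds (half_lt_self hqs))]
        with x hx hqx using ⟨hx, hqx⟩
    exact (mem_nhdsLE_iff_exists_Icc_subset).1 hev
  have har : a < r := (hr r (left_mem_Icc.2 hrs.le)).1.1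
  have hderiv : ∀ x ∈ Icc r s, HasDerivWithinAt
      (fun x => rlIntegral (1 - μ) a g x - q s / 2 * (x - r)) (q x - q s / 2) (Icc r s) x :=
    fun x hx => ((hd x (hr x hx).1).mono fun y hy => (hr y hy).1).sub (by
      simpa using ((hasDerivWithinAt_id x _).sub_const r).const_mul (q s / 2))
  have hmono : MonotoneOn (fun x => rlIntegral (1 - μ) a g x - q s / 2 * (x - r)) (Icc r s) :=
    monotoneOn_of_hasDerivWithinAt_nonneg (convex_Icc r s)
      (fun x hx => (hderiv x hx).continuousWithinAt)
      (fun x hx => (hderiv x (interior_subset hx)).mono interior_subset)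
      fun x hx => sub_nonneg.2 (hr x (interior_subset hx)).2.le
  have hrestart := monotoneOn_rlIntegral_sub_rlIntegral (μ := 1 - μ)
    ⟨sub_pos.2 hμ.2, by linarith [hμ.1]⟩ har.le hg
    fun x hx => hnonneg x ⟨hx.1, hx.2.trans hrs.le⟩
  have hbound := le_of_monotoneOn_rlIntegral_sub_mul (c := q s / 2) hμ hrs
    (hg.mono (Icc_subset_Icc_left har.le))
    ((hmono.add hrestart).congr fun x _ => by simp)
    (right_mem_Icc.2 hrs.le)
  rw [hgs] at hbound
  have hpow := Real.rpow_pos_of_pos (sub_pos.2 hrs) μ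
  have hΓ := Real.Gamma_pos_of_pos (add_pos hμ.1 one_pos)
  exact hbound.not_gt (mul_pos (div_pos hpow hΓ) (half_pos hqs))

theorem le_hasDerivWithinAt_rlIntegral_of_isMaxOn {s : ℝ} {q : ℝ → ℝ}
    (hμ : μ ∈ Ioo (0 : ℝ) 1) (has : a < s) (hg : ContinuousOn g (Icc a s))
    (hmax : IsMaxOn g (Icc a s) s)
    (hd : ∀ x ∈ Ioc a s, HasDerivWithinAt (rlIntegral (1 - μ) a g) (q x) (Ioc a s) x)
    (hq : ContinuousWithinAt q (Ioc a s) s) :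
    (s - a) ^ (-μ) / Real.Gamma (1 - μ) * g s ≤ q s := by
  have h1μ : 0 < 1 - μ := sub_pos.2 hμ.2
  have heq : EqOn (rlIntegral (1 - μ) a ((fun _ => g s) - g)) (fun x =>
      (x - a) ^ (1 - μ) / Real.Gamma (1 - μ + 1) * g s - rlIntegral (1 - μ) a g x) (Ioc a s) := by
    intro x hx
    have hsub : uIcc a x ⊆ Icc a s := by
      rw [uIcc_of_le hx.1.le]
      exact Icc_subset_Icc_right hx.2
    rw [rlIntegral_sub h1μ continuousOn_const (hg.mono hsub), rlIntegral_const h1μ]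
  refine sub_nonpos.1 (hasDerivWithinAt_rlIntegral_nonpos_of_eq_zero
    (q := fun x => (x - a) ^ (-μ) / Real.Gamma (1 - μ) * g s - q x) hμ has
    (continuousOn_const.sub hg) (fun x hx => sub_nonneg.2 (hmax hx)) (sub_self _)
    (fun x hx => ?_) ?_)
  · refine HasDerivWithinAt.congr (HasDerivWithinAt.sub ?_ (hd x hx)) heq (heq hx)
    have hpow := ((((hasDerivAt_id x).sub_const a).rpow_const (p := 1 - μ)
      (Or.inl (sub_ne_zero.2 hx.1.ne'))).div_const (Real.Gamma (1 - μ + 1))).mul_const (g s)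
    refine hpow.hasDerivWithinAt.congr_deriv ?_
    rw [Real.Gamma_add_one h1μ.ne', sub_sub_cancel_left, id]
    field_simp
  · refine ContinuousWithinAt.sub (ContinuousAt.continuousWithinAt ?_) hq
    exact (((continuousAt_id.sub continuousAt_const).rpow_const
      (Or.inl (sub_ne_zero.2 has.ne'))).div_const _).mul continuousAt_const

end RiemannLiouville

section ChangeOfVariable

variable {p a T t s : ℝ} {g : ℝ → ℝ}

theorem rpow_inv_mem_Ioc (hp : 0 < p) (ha : 0 ≤ a) (hT : 0 ≤ T)
    (hs : s ∈ Ioc (a ^ p) (T ^ p)) : s ^ p⁻¹ ∈ Ioc a T := by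
  have hs0 : 0 ≤ s := (Real.rpow_nonneg ha p).trans hs.1.le
  exact ⟨(Real.lt_rpow_inv_iff_of_pos ha hs0 hp).2 hs.1,
    (Real.rpow_inv_le_iff_of_pos hs0 hT hp).2 hs.2⟩

theorem rpow_inv_mem_Icc (hp : 0 < p) (ha : 0 ≤ a) (hT : 0 ≤ T)
    (hs : s ∈ Icc (a ^ p) (T ^ p)) : s ^ p⁻¹ ∈ Icc a T := by
  have hs0 : 0 ≤ s := (Real.rpow_nonneg ha p).trans hs.1
  exact ⟨(Real.le_rpow_inv_iff_of_pos ha hs0 hp).2 hs.1,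
    (Real.rpow_inv_le_iff_of_pos hs0 hT hp).2 hs.2⟩

theorem ekIntegral_eq_rlIntegral {γ δ : ℝ} (hp : 0 < p) (ha : 0 ≤ a) (hat : a ≤ t) :
    ekIntegral p γ δ a g t = t ^ (-p * (γ + δ)) *
      rlIntegral δ (a ^ p) (fun s => s ^ γ * g (s ^ p⁻¹)) (t ^ p) := by
  have hpos : ∀ x ∈ Ioo (min a t) (max a t), 0 < x := fun x hx =>
    ha.trans_lt ((min_eq_left hat) ▸ hx.1)
  have hsubst := intervalIntegral.integral_comp_mul_deriv_of_deriv_nonneg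
    (f := fun x => x ^ p) (f' := fun x => p * x ^ (p - 1))
    (g := fun s => (t ^ p - s) ^ (δ - 1) * (s ^ γ * g (s ^ p⁻¹)))
    (Real.continuous_rpow_const hp.le).continuousOn
    (fun x hx => Real.hasDerivAt_rpow_const (Or.inl (hpos x hx).ne'))
    (fun x hx => mul_nonneg hp.le (Real.rpow_nonneg (hpos x hx).le _))
  rw [ekIntegral, rlIntegral, ← hsubst, div_eq_mul_inv, mul_assoc]
  congr 2
  refine intervalIntegral.integral_congr fun x hx => ?_
  rw [uIcc_of_le hat] at hx
  have hx0 : 0 ≤ x := ha.trans hx.1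
  simp only [Function.comp_apply, Real.rpow_rpow_inv hx0 hp.ne', Real.rpow_mul hx0]
  ring

theorem ekIntegral_sub {γ δ : ℝ} {g₁ g₂ : ℝ → ℝ} (hγ : 0 ≤ γ) (hδ : 0 < δ) (hp : 0 < p)
    (ha : 0 ≤ a) (hat : a ≤ t) (h₁ : ContinuousOn g₁ (Icc a t)) (h₂ : ContinuousOn g₂ (Icc a t)) :
    ekIntegral p γ δ a (g₁ - g₂) t = ekIntegral p γ δ a g₁ t - ekIntegral p γ δ a g₂ t := by
  have ht : 0 ≤ t := ha.trans hat
  have hcomp : ∀ {g : ℝ → ℝ}, ContinuousOn g (Icc a t) →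
      ContinuousOn (fun s => s ^ γ * g (s ^ p⁻¹)) (uIcc (a ^ p) (t ^ p)) := by
    intro g hg
    rw [uIcc_of_le (Real.rpow_le_rpow ha hat hp.le)]
    exact (Real.continuous_rpow_const hγ).continuousOn.mul
      (hg.comp (Real.continuous_rpow_const (inv_nonneg.2 hp.le)).continuousOn
        fun s hs => rpow_inv_mem_Icc hp ha ht hs)
  simp only [ekIntegral_eq_rlIntegral hp ha hat]
  rw [← mul_sub, ← rlIntegral_sub hδ (hcomp h₁) (hcomp h₂)]
  simp only [Pi.sub_def, mul_sub]

end ChangeOfVariable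

section HyperBessel

variable {α θ a T t₀ : ℝ} {g g₁ g₂ : ℝ → ℝ}

theorem rlIntegral_comp_rpow_inv {s : ℝ} (hθ : θ < 1) (ha : 0 ≤ a) (hs : a ^ (1 - θ) < s) :
    rlIntegral (1 - α) (a ^ (1 - θ)) (fun σ => g (σ ^ (1 - θ)⁻¹)) s =
      s ^ (1 - α) * ekIntegral (1 - θ) (-α + α) (1 - α) a g (s ^ (1 - θ)⁻¹) := by
  have hp : 0 < 1 - θ := sub_pos.2 hθ
  have hs0 : 0 < s := (Real.rpow_nonneg ha _).trans_lt hs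
  have hexp : (1 - θ)⁻¹ * (-(1 - θ) * (0 + (1 - α))) = -(1 - α) := by field_simp; ring
  rw [ekIntegral_eq_rlIntegral hp ha ((Real.le_rpow_inv_iff_of_pos ha hs0.le hp).2 hs.le),
    Real.rpow_inv_rpow hs0.le hp.ne', ← Real.rpow_mul hs0.le, neg_add_cancel, hexp,
    Real.rpow_neg hs0.le, mul_inv_cancel_left₀ (Real.rpow_pos_of_pos hs0 _).ne']
  simp only [Real.rpow_zero, one_mul]

theorem HasHyperBessel.hasDerivWithinAt_rlIntegral (hg : HasHyperBessel α θ a T g) (hθ : θ < 1)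
    (ha : 0 ≤ a) (haT : a ≤ T) {s : ℝ} (hs : s ∈ Ioc (a ^ (1 - θ)) (T ^ (1 - θ))) :
    HasDerivWithinAt (rlIntegral (1 - α) (a ^ (1 - θ)) fun σ => g (σ ^ (1 - θ)⁻¹))
      ((1 - θ) ^ (-α) * hyperBessel α θ a T g (s ^ (1 - θ)⁻¹))
      (Ioc (a ^ (1 - θ)) (T ^ (1 - θ))) s := by
  have hp : 0 < 1 - θ := sub_pos.2 hθ
  have hs0 : 0 < s := (Real.rpow_nonneg ha _).trans_lt hs.1
  have hmaps : MapsTo (fun x : ℝ => x ^ (1 - θ)⁻¹) (Ioc (a ^ (1 - θ)) (T ^ (1 - θ))) (Ioc a T) :=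
    fun x hx => rpow_inv_mem_Ioc hp ha (ha.trans haT) hx
  have hpow : ∀ r, HasDerivWithinAt (fun x : ℝ => x ^ r) (r * s ^ (r - 1))
      (Ioc (a ^ (1 - θ)) (T ^ (1 - θ))) s := fun r =>
    (Real.hasDerivAt_rpow_const (Or.inl hs0.ne')).hasDerivWithinAt
  have hek := HasDerivWithinAt.comp s (hg _ (hmaps hs)).hasDerivWithinAt (hpow _) hmaps
  refine (((hpow (1 - α)).mul hek).congr (fun x hx => rlIntegral_comp_rpow_inv hθ ha hx.1)
    (rlIntegral_comp_rpow_inv hθ ha hs.1)).congr_deriv ?_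
  have hpre : (s ^ (1 - θ)⁻¹) ^ (-(1 - θ) * α) = s ^ (-α) := by
    rw [← Real.rpow_mul hs0.le]
    congr 1
    field_simp
  have hexp : s ^ (1 - α) * s ^ ((1 - θ)⁻¹ - 1) = s ^ (-α) * s ^ (1 - θ)⁻¹ := by
    rw [← Real.rpow_add hs0, ← Real.rpow_add hs0]
    ring_nf
  rw [hyperBessel, ekDeriv, hpre, sub_sub_cancel_left, mul_assoc ((1 - θ) ^ α),
    ← mul_assoc ((1 - θ) ^ (-α)), ← Real.rpow_add hp, neg_add_cancel, Real.rpow_zero,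
    Function.comp_apply]
  generalize ekIntegral (1 - θ) 0 (1 - α) a g = E
  linear_combination derivWithin E (Ioc a T) (s ^ (1 - θ)⁻¹) * (1 - θ)⁻¹ * hexp

theorem HasHyperBessel.le_hyperBessel_of_isMaxOn (hg : HasHyperBessel α θ a T g)
    (hα : α ∈ Ioo (0 : ℝ) 1) (hθ : θ < 1) (ha : 0 ≤ a) (ht₀ : t₀ ∈ Ioc a T)
    (hgc : ContinuousOn g (Icc a t₀))
    (hD : ContinuousWithinAt (hyperBessel α θ a T g) (Ioc a t₀) t₀)
    (hmax : IsMaxOn g (Icc a t₀) t₀) :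
    (1 - θ) ^ α * (t₀ ^ (1 - θ) - a ^ (1 - θ)) ^ (-α) / Real.Gamma (1 - α) * g t₀ ≤
      hyperBessel α θ a T g t₀ := by
  have hp : 0 < 1 - θ := sub_pos.2 hθ
  have ht₀0 : 0 ≤ t₀ := ha.trans ht₀.1.le
  have hinv : (t₀ ^ (1 - θ)) ^ (1 - θ)⁻¹ = t₀ := Real.rpow_rpow_inv ht₀0 hp.ne'
  have hcont : Continuous fun s : ℝ => s ^ (1 - θ)⁻¹ :=
    Real.continuous_rpow_const (inv_nonneg.2 hp.le)
  have hIcc : MapsTo (fun s : ℝ => s ^ (1 - θ)⁻¹) (Icc (a ^ (1 - θ)) (t₀ ^ (1 - θ))) (Icc a t₀) :=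
    fun s hs => rpow_inv_mem_Icc hp ha ht₀0 hs
  have hIoc : MapsTo (fun s : ℝ => s ^ (1 - θ)⁻¹) (Ioc (a ^ (1 - θ)) (t₀ ^ (1 - θ))) (Ioc a t₀) :=
    fun s hs => rpow_inv_mem_Ioc hp ha ht₀0 hs
  have hsub : Ioc (a ^ (1 - θ)) (t₀ ^ (1 - θ)) ⊆ Ioc (a ^ (1 - θ)) (T ^ (1 - θ)) :=
    Ioc_subset_Ioc_right (Real.rpow_le_rpow ht₀0 ht₀.2 hp.le)
  have hcomp : ContinuousWithinAt (fun s => hyperBessel α θ a T g (s ^ (1 - θ)⁻¹))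
      (Ioc (a ^ (1 - θ)) (t₀ ^ (1 - θ))) (t₀ ^ (1 - θ)) := by
    exact ContinuousWithinAt.comp (f := fun s : ℝ => s ^ (1 - θ)⁻¹) (t := Ioc a t₀)
      (by rwa [hinv]) hcont.continuousWithinAt hIoc
  have hbound := le_hasDerivWithinAt_rlIntegral_of_isMaxOn hα
    (Real.rpow_lt_rpow ha ht₀.1 hp) (hgc.comp hcont.continuousOn hIcc)
    (fun s hs => by simpa only [mem_ofPred_eq, Function.comp_apply, hinv] using hmax (hIcc hs))
    (fun s hs => (hg.hasDerivWithinAt_rlIntegral hθ ha (ht₀.1.le.trans ht₀.2) (hsub hs)).mono hsub)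
    (continuousWithinAt_const.mul hcomp)
  rw [Function.comp_apply, hinv, Real.rpow_neg hp.le,
    le_inv_mul_iff₀ (Real.rpow_pos_of_pos hp α)] at hbound
  rwa [mul_div_assoc, mul_assoc]

theorem continuousWithinAt_hyperBessel (hθ : θ < 1) (ha : 0 ≤ a) (hat₀ : a < t₀)
    (hD : ContinuousWithinAt (caputoHyperBessel α θ a T g) (Ioc a t₀) t₀) :
    ContinuousWithinAt (hyperBessel α θ a T g) (Ioc a t₀) t₀ := by
  have hp : 0 < 1 - θ := sub_pos.2 hθ
  have hsing : ContinuousAt (fun t => g a * (t ^ (1 - θ) - a ^ (1 - θ)) ^ (-α) /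
      ((1 - θ) ^ (-α) * Real.Gamma (1 - α))) t₀ :=
    (continuousAt_const.mul (((Real.continuous_rpow_const hp.le).continuousAt.sub
      continuousAt_const).rpow_const
        (Or.inl (sub_pos.2 (Real.rpow_lt_rpow ha hat₀ hp)).ne'))).div_const _
  simpa [caputoHyperBessel] using hD.fun_add hsing.continuousWithinAt

theorem HasHyperBessel.le_caputoHyperBessel_of_isMaxOn (hg : HasHyperBessel α θ a T g)
    (hα : α ∈ Ioo (0 : ℝ) 1) (hθ : θ < 1) (ha : 0 ≤ a) (ht₀ : t₀ ∈ Ioc a T)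
    (hgc : ContinuousOn g (Icc a t₀))
    (hD : ContinuousWithinAt (caputoHyperBessel α θ a T g) (Ioc a t₀) t₀)
    (hmax : IsMaxOn g (Icc a t₀) t₀) :
    (1 - θ) ^ α * (t₀ ^ (1 - θ) - a ^ (1 - θ)) ^ (-α) / Real.Gamma (1 - α) * (g t₀ - g a) ≤
      caputoHyperBessel α θ a T g t₀ := by
  have hbound := hg.le_hyperBessel_of_isMaxOn hα hθ ha ht₀ hgc
    (continuousWithinAt_hyperBessel hθ ha ht₀.1 hD) hmax
  have hsing : g a * (t₀ ^ (1 - θ) - a ^ (1 - θ)) ^ (-α) /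
        ((1 - θ) ^ (-α) * Real.Gamma (1 - α)) =
      (1 - θ) ^ α * (t₀ ^ (1 - θ) - a ^ (1 - θ)) ^ (-α) / Real.Gamma (1 - α) * g a := by
    rw [Real.rpow_neg (sub_pos.2 hθ).le α, div_mul_eq_div_div, div_inv_eq_mul]
    ring
  rw [caputoHyperBessel, hsing, mul_sub]
  exact sub_le_sub_right hbound _

theorem HasHyperBessel.caputoHyperBessel_pos_of_isMaxOn (hg : HasHyperBessel α θ a T g)
    (hα : α ∈ Ioo (0 : ℝ) 1) (hθ : θ < 1) (ha : 0 ≤ a) (ht₀ : t₀ ∈ Ioc a T)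
    (hgc : ContinuousOn g (Icc a t₀))
    (hD : ContinuousWithinAt (caputoHyperBessel α θ a T g) (Ioc a t₀) t₀)
    (hmax : IsMaxOn g (Icc a t₀) t₀) (hlt : g a < g t₀) : 0 < caputoHyperBessel α θ a T g t₀ := by
  have hp := Real.rpow_pos_of_pos (sub_pos.2 hθ) α
  have hS := Real.rpow_pos_of_pos (sub_pos.2 (Real.rpow_lt_rpow ha ht₀.1 (sub_pos.2 hθ))) (-α)
  have hΓ := Real.Gamma_pos_of_pos (sub_pos.2 hα.2)
  exact (mul_pos (div_pos (mul_pos hp hS) hΓ) (sub_pos.2 hlt)).trans_le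
    (hg.le_caputoHyperBessel_of_isMaxOn hα hθ ha ht₀ hgc hD hmax)

theorem eqOn_ekIntegral_sub (hα : α < 1) (hθ : θ < 1) (ha : 0 ≤ a)
    (hc₁ : ContinuousOn g₁ (Icc a T)) (hc₂ : ContinuousOn g₂ (Icc a T)) :
    EqOn (ekIntegral (1 - θ) (-α + α) (1 - α) a (g₁ - g₂))
      (ekIntegral (1 - θ) (-α + α) (1 - α) a g₁ - ekIntegral (1 - θ) (-α + α) (1 - α) a g₂)
      (Ioc a T) := fun _ ht =>
  ekIntegral_sub (neg_add_cancel α).ge (sub_pos.2 hα) (sub_pos.2 hθ) ha ht.1.le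
    (hc₁.mono (Icc_subset_Icc_right ht.2)) (hc₂.mono (Icc_subset_Icc_right ht.2))

theorem HasHyperBessel.sub (hα : α < 1) (hθ : θ < 1) (ha : 0 ≤ a)
    (hc₁ : ContinuousOn g₁ (Icc a T)) (hc₂ : ContinuousOn g₂ (Icc a T))
    (h₁ : HasHyperBessel α θ a T g₁) (h₂ : HasHyperBessel α θ a T g₂) :
    HasHyperBessel α θ a T (g₁ - g₂) :=
  (DifferentiableOn.sub h₁ h₂).congr (eqOn_ekIntegral_sub hα hθ ha hc₁ hc₂)

theorem caputoHyperBessel_sub (hα : α < 1) (hθ : θ < 1) (ha : 0 ≤ a)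
    (hc₁ : ContinuousOn g₁ (Icc a T)) (hc₂ : ContinuousOn g₂ (Icc a T))
    (h₁ : HasHyperBessel α θ a T g₁) (h₂ : HasHyperBessel α θ a T g₂) :
    EqOn (caputoHyperBessel α θ a T (g₁ - g₂))
      (caputoHyperBessel α θ a T g₁ - caputoHyperBessel α θ a T g₂) (Ioc a T) := by
  intro t ht
  have heq := eqOn_ekIntegral_sub hα hθ ha hc₁ hc₂
  simp only [caputoHyperBessel, hyperBessel, ekDeriv, Pi.sub_apply]
  rw [derivWithin_congr heq (heq ht), derivWithin_sub (h₁ t ht) (h₂ t ht), heq ht, Pi.sub_apply]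
  ring

end HyperBessel

section DegenerateElliptic

variable {β x : ℝ} {v v₁ v₂ : ℝ → ℝ}

theorem nonpos_of_hasDerivAt_mul_deriv_of_isLocalMax {ρ : ℝ → ℝ} {c : ℝ} (hmax : IsLocalMax v x)
    (hv : ContinuousAt v x) (hρ : ∀ᶠ y in 𝓝[>] x, 0 < ρ y)
    (hd : HasDerivAt (fun y => ρ y * deriv v y) c x) : c ≤ 0 := by
  by_contra! hc
  have hflux : ∀ᶠ y in 𝓝[>] x, 0 < slope (fun y => ρ y * deriv v y) x y :=
    ((hasDerivAt_iff_tendsto_slope.1 hd).mono_left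
      (nhdsWithin_mono _ fun y hy => ne_of_gt hy)).eventually (lt_mem_nhds hc)
  have hpos : ∀ᶠ y in 𝓝[>] x, 0 < deriv v y ∧ v y ≤ v x := by
    filter_upwards [hflux, hρ, self_mem_nhdsWithin, hmax.filter_mono nhdsWithin_le_nhds]
      with y hslope hρy hxy hle
    rw [slope_def_field, hmax.deriv_eq_zero, mul_zero, sub_zero,
      div_pos_iff_of_pos_right (sub_pos.2 hxy)] at hslope
    exact ⟨(mul_pos_iff_of_pos_left hρy).1 hslope, hle⟩
  obtain ⟨z, hxz, hz⟩ := mem_nhdsGT_iff_exists_Ioc_subset.1 hpos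
  have hxz : x < z := hxz
  have hcont : ContinuousOn v (Icc x z) := fun y hy => by
    rcases hy.1.eq_or_lt with rfl | hxy
    · exact hv.continuousWithinAt
    · exact (differentiableAt_of_deriv_ne_zero
        (hz ⟨hxy, hy.2⟩).1.ne').continuousAt.continuousWithinAt
  have hmono : StrictMonoOn v (Icc x z) :=
    strictMonoOn_of_deriv_pos (convex_Icc x z) hcont fun y hy => by
      rw [interior_Icc] at hy
      exact (hz (Ioo_subset_Ioc_self hy)).1
  exact (hmono (left_mem_Icc.2 hxz.le) (right_mem_Icc.2 hxz.le) hxz).not_ge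
    (hz (right_mem_Ioc.2 hxz)).2

theorem opA_nonneg_of_isLocalMax (hx : 0 < x) (hmax : IsLocalMax v x) (hv : ContinuousAt v x)
    (hd : DifferentiableAt ℝ (fun y => y ^ β * deriv v y) x) : 0 ≤ opA β v x := by
  refine neg_nonneg.2 (nonpos_of_hasDerivAt_mul_deriv_of_isLocalMax hmax hv ?_ hd.hasDerivAt)
  filter_upwards [self_mem_nhdsWithin] with y hy using Real.rpow_pos_of_pos (hx.trans hy) β

theorem rpow_mul_deriv_sub_eventuallyEq (h₁ : ∀ᶠ y in 𝓝 x, DifferentiableAt ℝ v₁ y)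
    (h₂ : ∀ᶠ y in 𝓝 x, DifferentiableAt ℝ v₂ y) :
    (fun y => y ^ β * deriv (v₁ - v₂) y) =ᶠ[𝓝 x]
      (fun y => y ^ β * deriv v₁ y) - fun y => y ^ β * deriv v₂ y := by
  filter_upwards [h₁, h₂] with y hy₁ hy₂
  rw [deriv_sub hy₁ hy₂, Pi.sub_apply, mul_sub]

theorem opA_sub (h₁ : ∀ᶠ y in 𝓝 x, DifferentiableAt ℝ v₁ y)
    (h₂ : ∀ᶠ y in 𝓝 x, DifferentiableAt ℝ v₂ y)
    (hd₁ : DifferentiableAt ℝ (fun y => y ^ β * deriv v₁ y) x)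
    (hd₂ : DifferentiableAt ℝ (fun y => y ^ β * deriv v₂ y) x) :
    opA β (v₁ - v₂) x = opA β v₁ x - opA β v₂ x := by
  rw [opA, (rpow_mul_deriv_sub_eventuallyEq h₁ h₂).deriv_eq, deriv_sub hd₁ hd₂, opA, opA]
  ring

end DegenerateElliptic

theorem eq_of_tendsto_nhdsGT {X : Type*} [TopologicalSpace X] [T2Space X] {a T : ℝ} (haT : a < T)
    {u : ℝ → X} {φ : X} (hu : ContinuousOn u (Icc a T)) (h : Tendsto u (𝓝[>] a) (𝓝 φ)) :
    u a = φ := by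
  have hright := (hu a (left_mem_Icc.2 haT.le)).mono Ioc_subset_Icc_self
  rw [ContinuousWithinAt, nhdsWithin_Ioc_eq_nhdsGT haT] at hright
  exact tendsto_nhds_unique hright h

section Classical

variable {α θ β a T x t : ℝ} {f f₁ f₂ u u₁ u₂ : ℝ → ℝ → ℝ} {φ φ₁ φ₂ : ℝ → ℝ}

theorem IsClassicalSolution.continuousOn_time (h : IsClassicalSolution α θ β a T f φ u)
    (hx : x ∈ Icc (0 : ℝ) 1) : ContinuousOn (u x) (Icc a T) :=
  h.continuousOn.comp (f := fun t : ℝ => (x, t)) (by fun_prop) fun _ ht => ⟨hx, ht⟩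

theorem IsClassicalSolution.continuousOn_caputoHyperBessel
    (h : IsClassicalSolution α θ β a T f φ u) (hx : x ∈ Ioo (0 : ℝ) 1) :
    ContinuousOn (caputoHyperBessel α θ a T (u x)) (Ioc a T) :=
  h.time_continuousOn.comp (f := fun t : ℝ => (x, t)) (by fun_prop) fun _ ht => ⟨hx, ht⟩

theorem IsClassicalSolution.eventually_differentiableAt
    (h : IsClassicalSolution α θ β a T f φ u) (hx : x ∈ Ioo (0 : ℝ) 1) (ht : t ∈ Ioc a T) :
    ∀ᶠ y in 𝓝 x, DifferentiableAt ℝ (fun y => u y t) y := by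
  filter_upwards [Ioo_mem_nhds hx.1 hx.2] with y hy using (h.space_exists t ht y hy).1

theorem IsClassicalSolution.caputoHyperBessel_sub (hα : α < 1) (hθ : θ < 1) (ha : 0 ≤ a)
    (h₁ : IsClassicalSolution α θ β a T f₁ φ₁ u₁) (h₂ : IsClassicalSolution α θ β a T f₂ φ₂ u₂)
    (hx : x ∈ Ioo (0 : ℝ) 1) (ht : t ∈ Ioc a T) :
    caputoHyperBessel α θ a T ((u₁ - u₂) x) t =
      caputoHyperBessel α θ a T (u₁ x) t - caputoHyperBessel α θ a T (u₂ x) t :=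
  have hx' := Ioo_subset_Icc_self hx
  DegenerateFractional.caputoHyperBessel_sub hα hθ ha (h₁.continuousOn_time hx')
    (h₂.continuousOn_time hx') (h₁.time_exists x hx) (h₂.time_exists x hx) ht

theorem IsClassicalSolution.opA_sub (h₁ : IsClassicalSolution α θ β a T f₁ φ₁ u₁)
    (h₂ : IsClassicalSolution α θ β a T f₂ φ₂ u₂) (hx : x ∈ Ioo (0 : ℝ) 1) (ht : t ∈ Ioc a T) :
    opA β (fun y => (u₁ - u₂) y t) x = opA β (fun y => u₁ y t) x - opA β (fun y => u₂ y t) x :=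
  DegenerateFractional.opA_sub (h₁.eventually_differentiableAt hx ht)
    (h₂.eventually_differentiableAt hx ht) (h₁.space_exists t ht x hx).2
    (h₂.space_exists t ht x hx).2

theorem IsClassicalSolution.sub (hα : α < 1) (hθ : θ < 1) (ha : 0 ≤ a)
    (h₁ : IsClassicalSolution α θ β a T f₁ φ₁ u₁) (h₂ : IsClassicalSolution α θ β a T f₂ φ₂ u₂) :
    IsClassicalSolution α θ β a T (f₁ - f₂) (φ₁ - φ₂) (u₁ - u₂) where
  continuousOn := h₁.continuousOn.sub h₂.continuousOn
  time_exists x hx := (h₁.time_exists x hx).sub hα hθ ha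
    (h₁.continuousOn_time (Ioo_subset_Icc_self hx)) (h₂.continuousOn_time (Ioo_subset_Icc_self hx))
    (h₂.time_exists x hx)
  time_continuousOn := (h₁.time_continuousOn.sub h₂.time_continuousOn).congr fun _ hz =>
    h₁.caputoHyperBessel_sub hα hθ ha h₂ hz.1 hz.2
  space_exists t ht x hx :=
    ⟨(h₁.space_exists t ht x hx).1.sub (h₂.space_exists t ht x hx).1,
      ((h₁.space_exists t ht x hx).2.sub (h₂.space_exists t ht x hx).2).congr_of_eventuallyEq
        (rpow_mul_deriv_sub_eventuallyEq (h₁.eventually_differentiableAt hx ht)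
          (h₂.eventually_differentiableAt hx ht))⟩
  space_continuousOn := (h₁.space_continuousOn.sub h₂.space_continuousOn).congr fun _ hz =>
    h₁.opA_sub h₂ hz.1 hz.2
  equation x hx t ht := by
    rw [h₁.caputoHyperBessel_sub hα hθ ha h₂ hx ht, h₁.opA_sub h₂ hx ht, Pi.sub_apply,
      Pi.sub_apply, ← h₁.equation x hx t ht, ← h₂.equation x hx t ht]
    ring
  initial x hx := (h₁.initial x hx).sub (h₂.initial x hx)
  boundary_left hβ t ht := by simp [h₁.boundary_left hβ t ht, h₂.boundary_left hβ t ht]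
  boundary_right t ht := by simp [h₁.boundary_right t ht, h₂.boundary_right t ht]

theorem IsClassicalSolution.nonpos (hα : α ∈ Ioo (0 : ℝ) 1) (hθ : θ < 1) (ha : 0 ≤ a)
    (haT : a < T) (hβ : β < 1) (h : IsClassicalSolution α θ β a T f φ u)
    (hf : ∀ x ∈ Ioo (0 : ℝ) 1, ∀ t ∈ Ioc a T, f x t ≤ 0) (hφ : ∀ x ∈ Icc (0 : ℝ) 1, φ x ≤ 0)
    (hx : x ∈ Icc (0 : ℝ) 1) (ht : t ∈ Icc a T) : u x t ≤ 0 := by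
  obtain ⟨⟨x₀, t₀⟩, ⟨hx₀, ht₀⟩, hmax⟩ :=
    (isCompact_Icc.prod isCompact_Icc).exists_isMaxOn ⟨(x, t), hx, ht⟩ h.continuousOn
  have hle : ∀ y ∈ Icc (0 : ℝ) 1, ∀ s ∈ Icc a T, u y s ≤ u x₀ t₀ := fun y hy s hs =>
    hmax (mk_mem_prod hy hs)
  refine (hle x hx t ht).trans (not_lt.1 fun hpos => ?_)
  have hinit : u x₀ a ≤ 0 :=
    (eq_of_tendsto_nhdsGT haT (h.continuousOn_time hx₀) (h.initial x₀ hx₀)).trans_le (hφ x₀ hx₀)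
  have hta : t₀ ≠ a := by rintro rfl; exact hpos.not_ge hinit
  have hx0 : x₀ ≠ 0 := by rintro rfl; exact hpos.ne' (h.boundary_left hβ t₀ ht₀)
  have hx1 : x₀ ≠ 1 := by rintro rfl; exact hpos.ne' (h.boundary_right t₀ ht₀)
  replace hx₀ : x₀ ∈ Ioo (0 : ℝ) 1 := ⟨hx₀.1.lt_of_ne' hx0, hx₀.2.lt_of_ne hx1⟩
  replace ht₀ : t₀ ∈ Ioc a T := ⟨ht₀.1.lt_of_ne' hta, ht₀.2⟩
  have htime : 0 < caputoHyperBessel α θ a T (u x₀) t₀ :=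
    (h.time_exists x₀ hx₀).caputoHyperBessel_pos_of_isMaxOn hα hθ ha ht₀
      ((h.continuousOn_time (Ioo_subset_Icc_self hx₀)).mono (Icc_subset_Icc_right ht₀.2))
      ((h.continuousOn_caputoHyperBessel hx₀ t₀ ht₀).mono (Ioc_subset_Ioc_right ht₀.2))
      (fun s hs => hle x₀ (Ioo_subset_Icc_self hx₀) s (Icc_subset_Icc_right ht₀.2 hs))
      (hinit.trans_lt hpos)
  have hspace : 0 ≤ opA β (fun y => u y t₀) x₀ := by
    obtain ⟨hd, hdflux⟩ := h.space_exists t₀ ht₀ x₀ hx₀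
    refine opA_nonneg_of_isLocalMax hx₀.1 ?_ hd.continuousAt hdflux
    filter_upwards [Icc_mem_nhds hx₀.1 hx₀.2] with y hy using hle y hy t₀ (Ioc_subset_Icc_self ht₀)
  exact absurd (h.equation x₀ hx₀ t₀ ht₀) (by linarith [hf x₀ hx₀ t₀ ht₀])

theorem IsClassicalSolution.le (hα : α ∈ Ioo (0 : ℝ) 1) (hθ : θ < 1) (ha : 0 ≤ a) (haT : a < T)
    (hβ : β < 1) (h₁ : IsClassicalSolution α θ β a T f₁ φ₁ u₁)
    (h₂ : IsClassicalSolution α θ β a T f₂ φ₂ u₂)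
    (hf : ∀ x ∈ Ioo (0 : ℝ) 1, ∀ t ∈ Ioc a T, f₁ x t ≤ f₂ x t)
    (hφ : ∀ x ∈ Icc (0 : ℝ) 1, φ₁ x ≤ φ₂ x) (hx : x ∈ Icc (0 : ℝ) 1) (ht : t ∈ Icc a T) :
    u₁ x t ≤ u₂ x t :=
  have h : (u₁ - u₂) x t ≤ 0 := (h₁.sub hα.2 hθ ha h₂).nonpos hα hθ ha haT hβ
    (fun y hy s hs => sub_nonpos.2 (hf y hy s hs)) (fun y hy => sub_nonpos.2 (hφ y hy)) hx ht
  sub_nonpos.1 h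

theorem IsClassicalSolution.unique (hα : α ∈ Ioo (0 : ℝ) 1) (hθ : θ < 1) (ha : 0 ≤ a)
    (haT : a < T) (hβ : β < 1) (h₁ : IsClassicalSolution α θ β a T f φ u₁)
    (h₂ : IsClassicalSolution α θ β a T f φ u₂) (hx : x ∈ Icc (0 : ℝ) 1) (ht : t ∈ Icc a T) :
    u₁ x t = u₂ x t :=
  have hf : ∀ y ∈ Ioo (0 : ℝ) 1, ∀ s ∈ Ioc a T, f y s ≤ f y s := fun _ _ _ _ => le_rfl
  have hφ : ∀ y ∈ Icc (0 : ℝ) 1, φ y ≤ φ y := fun _ _ => le_rfl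
  (h₁.le hα hθ ha haT hβ h₂ hf hφ hx ht).antisymm (h₂.le hα hθ ha haT hβ h₁ hf hφ hx ht)

end Classical

section Weak

variable {α θ β a T : ℝ}

theorem eqOn_zero_of_caputoHyperBessel_inner_nonpos {E : Type*} [NormedAddCommGroup E]
    [InnerProductSpace ℝ E] {u : ℝ → E} (hα : α ∈ Ioo (0 : ℝ) 1) (hθ : θ < 1) (ha : 0 ≤ a)
    (hu : ContinuousOn u (Icc a T)) (hua : u a = 0)
    (hH : ∀ t₀ ∈ Ioc a T, HasHyperBessel α θ a T fun t => inner ℝ (u t) (u t₀))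
    (hD : ∀ t₀ ∈ Ioc a T,
      ContinuousOn (caputoHyperBessel α θ a T fun t => inner ℝ (u t) (u t₀)) (Ioc a T))
    (hle : ∀ t₀ ∈ Ioc a T, caputoHyperBessel α θ a T (fun t => inner ℝ (u t) (u t₀)) t₀ ≤ 0) :
    EqOn u 0 (Icc a T) := by
  intro t ht
  obtain ⟨t₀, ht₀, hmax⟩ := isCompact_Icc.exists_isMaxOn ⟨t, ht⟩ hu.norm
  by_contra hne
  have hpos : 0 < ‖u t₀‖ := (norm_pos_iff.2 hne).trans_le (hmax ht)
  have hta : t₀ ≠ a := by rintro rfl; exact norm_pos_iff.1 hpos hua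
  replace ht₀ : t₀ ∈ Ioc a T := ⟨ht₀.1.lt_of_ne' hta, ht₀.2⟩
  have hsub : Icc a t₀ ⊆ Icc a T := Icc_subset_Icc_right ht₀.2
  have hinner : IsMaxOn (fun t => inner ℝ (u t) (u t₀)) (Icc a t₀) t₀ := fun s hs =>
    calc inner ℝ (u s) (u t₀) ≤ ‖u s‖ * ‖u t₀‖ := real_inner_le_norm _ _
      _ ≤ ‖u t₀‖ * ‖u t₀‖ := by gcongr; exact hmax (hsub hs)
      _ = inner ℝ (u t₀) (u t₀) := (real_inner_self_eq_norm_mul_norm _).symm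
  refine (hle t₀ ht₀).not_gt ((hH t₀ ht₀).caputoHyperBessel_pos_of_isMaxOn hα hθ ha ht₀
    ((hu.mono hsub).inner continuousOn_const)
    ((hD t₀ ht₀ t₀ ht₀).mono (Ioc_subset_Ioc_right ht₀.2)) hinner ?_)
  rw [hua, inner_zero_left, real_inner_self_eq_norm_mul_norm]
  exact mul_pos hpos hpos

theorem MemDomainA.sub {v₁ v₂ : ℝ → ℝ} (h₁ : MemDomainA β v₁) (h₂ : MemDomainA β v₂) :
    MemDomainA β (v₁ - v₂) where
  continuousOn := h₁.continuousOn.sub h₂.continuousOn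
  differentiableAt x hx := (h₁.differentiableAt x hx).sub (h₂.differentiableAt x hx)
  flux := by
    obtain ⟨w₁, z₁, hw₁, hflux₁, hderiv₁, hz₁⟩ := h₁.flux
    obtain ⟨w₂, z₂, hw₂, hflux₂, hderiv₂, hz₂⟩ := h₂.flux
    refine ⟨w₁ - w₂, z₁ - z₂, hw₁.sub hw₂, fun x hx => ?_,
      fun x hx => (hderiv₁ x hx).sub (hderiv₂ x hx), hz₁.sub hz₂⟩
    rw [deriv_sub (h₁.differentiableAt x hx) (h₂.differentiableAt x hx), Pi.sub_apply,
      hflux₁ x hx, hflux₂ x hx, mul_sub]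
  boundary_left hβ := by simp [h₁.boundary_left hβ, h₂.boundary_left hβ]
  boundary_right := by simp [h₁.boundary_right, h₂.boundary_right]

theorem sub_mem_domainGraph {p q : L2 × L2} (hp : p ∈ domainGraph β) (hq : q ∈ domainGraph β) :
    p - q ∈ domainGraph β := by
  obtain ⟨v, hv, hp₁, hp₂⟩ := hp
  obtain ⟨w, hw, hq₁, hq₂⟩ := hq
  refine ⟨v - w, hv.sub hw, ?_, ?_⟩
  · exact (Lp.coeFn_sub p.1 q.1).trans (hp₁.sub hq₁)
  · filter_upwards [Lp.coeFn_sub p.2 q.2, hp₂, hq₂, ae_restrict_mem measurableSet_Ioo]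
      with x hx hpx hqx hmem
    rw [Prod.snd_sub, hx, Pi.sub_apply, hpx, hqx, ← mul_sub,
      deriv_sub (hv.differentiableAt x hmem) (hw.differentiableAt x hmem)]

theorem sub_mem_weightedSobolev {p q : L2 × L2} (hp : p ∈ weightedSobolev β)
    (hq : q ∈ weightedSobolev β) : p - q ∈ weightedSobolev β :=
  map_mem_closure₂ continuous_sub hp hq fun _ hp _ hq => sub_mem_domainGraph hp hq

theorem IsWeakSolution.sub {f₁ f₂ u₁ u₂ : ℝ → L2} {φ₁ φ₂ : L2} (hα : α < 1) (hθ : θ < 1)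
    (ha : 0 ≤ a) (h₁ : IsWeakSolution α θ β a T f₁ φ₁ u₁)
    (h₂ : IsWeakSolution α θ β a T f₂ φ₂ u₂) :
    IsWeakSolution α θ β a T (f₁ - f₂) (φ₁ - φ₂) (u₁ - u₂) where
  continuousOn := h₁.continuousOn.sub h₂.continuousOn
  initial := h₁.initial.sub h₂.initial
  weak := by
    obtain ⟨d₁, g₁, hmem₁, hd₁, hA₁, hg₁, hweak₁⟩ := h₁.weak
    obtain ⟨d₂, g₂, hmem₂, hd₂, hA₂, hg₂, hweak₂⟩ := h₂.weak
    refine ⟨d₁ - d₂, g₁ - g₂, fun t ht => sub_mem_weightedSobolev (hmem₁ t ht) (hmem₂ t ht),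
      hd₁.sub hd₂, fun t ht ω hω => ?_, hg₁.sub hg₂, fun ω hω => ?_⟩
    · simp only [Pi.sub_apply, inner_sub_left, hA₁ t ht ω hω, hA₂ t ht ω hω]
    · obtain ⟨hH₁, hequation₁⟩ := hweak₁ ω hω
      obtain ⟨hH₂, hequation₂⟩ := hweak₂ ω hω
      have hc₁ := h₁.continuousOn.inner (𝕜 := ℝ) (continuousOn_const (c := ω.1))
      have hc₂ := h₂.continuousOn.inner (𝕜 := ℝ) (continuousOn_const (c := ω.1))
      have hinner : (fun t => inner ℝ ((u₁ - u₂) t) ω.1) =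
          (fun t => inner ℝ (u₁ t) ω.1) - fun t => inner ℝ (u₂ t) ω.1 :=
        funext fun t => inner_sub_left _ _ _
      rw [hinner]
      refine ⟨hH₁.sub hα hθ ha hc₁ hc₂ hH₂, fun t ht => ?_⟩
      rw [caputoHyperBessel_sub hα hθ ha hc₁ hc₂ hH₁ hH₂ ht]
      simp only [Pi.sub_apply, inner_sub_left, ← hequation₁ t ht, ← hequation₂ t ht]
      ring

theorem IsWeakSolution.eqOn_zero {u : ℝ → L2} (hα : α ∈ Ioo (0 : ℝ) 1) (hθ : θ < 1) (ha : 0 ≤ a)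
    (haT : a < T) (h : IsWeakSolution α θ β a T 0 0 u) : EqOn u 0 (Icc a T) := by
  obtain ⟨d, -, hmem, hd, -, -, hweak⟩ := h.weak
  have hcaputo : ∀ t₀ ∈ Ioc a T, ∀ t ∈ Ioc a T,
      caputoHyperBessel α θ a T (fun s => inner ℝ (u s) (u t₀)) t = -inner ℝ (d t) (d t₀) := by
    intro t₀ ht₀ t ht
    have hequation := (hweak _ (hmem t₀ ht₀)).2 t ht
    rw [Pi.zero_apply, inner_zero_left] at hequation
    exact eq_neg_of_add_eq_zero_left hequation
  refine eqOn_zero_of_caputoHyperBessel_inner_nonpos hα hθ ha h.continuousOn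
    (eq_of_tendsto_nhdsGT haT h.continuousOn h.initial) (fun t₀ ht₀ => (hweak _ (hmem t₀ ht₀)).1)
    (fun t₀ ht₀ => ((hd.inner continuousOn_const).neg).congr (hcaputo t₀ ht₀)) fun t₀ ht₀ => ?_
  rw [hcaputo t₀ ht₀ t₀ ht₀]
  exact neg_nonpos.2 real_inner_self_nonneg

theorem IsWeakSolution.eqOn {f u₁ u₂ : ℝ → L2} {φ : L2} (hα : α ∈ Ioo (0 : ℝ) 1) (hθ : θ < 1)
    (ha : 0 ≤ a) (haT : a < T) (h₁ : IsWeakSolution α θ β a T f φ u₁)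
    (h₂ : IsWeakSolution α θ β a T f φ u₂) : EqOn u₁ u₂ (Icc a T) := by
  have h := h₁.sub hα.2 hθ ha h₂
  rw [sub_self, sub_self] at h
  exact fun t ht => sub_eq_zero.1 (h.eqOn_zero hα hθ ha haT ht)

end Weak

end DegenerateFractional

theorem mainTheorem6_general (α θ β a T : ℝ) (hα : α ∈ Ioo (0 : ℝ) 1) (hθ : θ < 1) (ha : 0 ≤ a)
    (haT : a < T) :
    (β < 1 →
      ∀ (f : ℝ → ℝ → ℝ) (φ : ℝ → ℝ) (u₁ u₂ : ℝ → ℝ → ℝ),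
        DegenerateFractional.IsClassicalSolution α θ β a T f φ u₁ →
        DegenerateFractional.IsClassicalSolution α θ β a T f φ u₂ →
        ∀ x ∈ Icc (0 : ℝ) 1, ∀ t ∈ Icc a T, u₁ x t = u₂ x t) ∧
    ∀ (f : ℝ → DegenerateFractional.L2) (φ : DegenerateFractional.L2)
      (u₁ u₂ : ℝ → DegenerateFractional.L2),
      DegenerateFractional.IsWeakSolution α θ β a T f φ u₁ →
      DegenerateFractional.IsWeakSolution α θ β a T f φ u₂ →
      ∀ t ∈ Icc a T, u₁ t = u₂ t :=
  ⟨fun hβ _ _ _ _ h₁ h₂ _ hx _ ht => h₁.unique hα hθ ha haT hβ h₂ hx ht,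
    fun _ _ _ _ h₁ h₂ _ ht => h₁.eqOn hα hθ ha haT h₂ ht⟩

theorem mainTheorem6 (α θ β a T : ℝ) (hα : α ∈ Set.Ioo (0 : ℝ) 1) (hθ : θ < 1) (ha : 0 ≤ a)
    (haT : a < T) :
    (β ∈ Set.Ioo (0 : ℝ) 1 →
      ∀ (f : ℝ → ℝ → ℝ) (φ : ℝ → ℝ) (u₁ u₂ : ℝ → ℝ → ℝ),
        DegenerateFractional.IsClassicalSolution α θ β a T f φ u₁ →
        DegenerateFractional.IsClassicalSolution α θ β a T f φ u₂ →
        ∀ x ∈ Set.Icc (0 : ℝ) 1, ∀ t ∈ Set.Icc a T, u₁ x t = u₂ x t) ∧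
    (β ∈ Set.Ioo (1 : ℝ) 2 →
      ∀ (f : ℝ → DegenerateFractional.L2) (φ : DegenerateFractional.L2)
        (u₁ u₂ : ℝ → DegenerateFractional.L2),
        DegenerateFractional.IsWeakSolution α θ β a T f φ u₁ →
        DegenerateFractional.IsWeakSolution α θ β a T f φ u₂ →
        ∀ t ∈ Set.Icc a T, u₁ t = u₂ t) :=
  have hunique := mainTheorem6_general α θ β a T hα hθ ha haT
  ⟨fun hβ => hunique.1 hβ.2, fun _ => hunique.2⟩
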